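/- Let $H$ be a complex Hilbert space, let $\mathcal{E}(H)$ be the set of quantum effects on $H$, i.e. the bounded operators $A$ with $0\le A\le I$, and let $\mathcal{D}(H)\subseteq\mathcal{E}(H)$ be the set of states (density operators), i.e. the positive trace-class operators of trace $1$. A pure state is an orthogonal projection of rank one. A binary operation $\circ$ on $\mathcal{E}(H)$ is called a sequential product if, for all $A,B\in\mathcal{E}(H)$: 1. (Duality) for every $\rho\in\mathcal{D}(H)$, the operators $(A\circ\rho)B$ and $\rho(A\circ B)$ are trace-class and $\operatorname{Tr}((A\circ\rho)B)=\operatorname{Tr}(\rho(A\circ B))$; 2. (Unit) $A\circ I=I\circ A=A$; 3. (Weak associativity) $A^2\circ B=A\circ(A\circ B)$; 4. (Continuity) the map $E\mapsto E\circ B$ from $\mathcal{E}(H)$ to $\mathcal{E}(H)$ is continuous for the strong operator topology; 5. (Purity) for every pure state $P$ with $A\circ P\neq 0$, the operator $\frac{1}{\operatorname{Tr}(A\circ P)}(A\circ P)$ is a pure state. Theorem. A binary operation $\circ$ on $\mathcal{E}(H)$ is a sequential product if and only if $A\circ B=A^{1/2}BA^{1/2}$ for all $A,B\in\mathcal{E}(H)$.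 -/

import Mathlib

namespace QuantumEffects

variable {H : Type*} [NormedAddCommGroup H] [InnerProductSpace ℂ H] [CompleteSpace H]

set_option linter.unusedSectionVars false

/-- A bounded operator `T` on a Hilbert space is trace class if `∑ ⟪e i, |T| (e i)⟫` converges
for every orthonormal (Hilbert) basis `e`, where `|T| = (T⋆ T)^{1/2}`.  Indexing the basis by a set
of vectors of `H` is no restriction, since a basis may be indexed by its own range. -/
def IsTraceClass (T : H →L[ℂ] H) : Prop :=
  ∀ (w : Set H) (b : HilbertBasis w ℂ H), Summable fun i : w => inner ℂ (b i) (CFC.abs T (b i))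

variable (H) in
/-- The index set of a fixed orthonormal (Hilbert) basis of `H`. -/
noncomputable def basisIndex : Set H := (exists_hilbertBasis ℂ H).choose

variable (H) in
/-- A fixed orthonormal (Hilbert) basis of `H`, used to compute traces. -/
noncomputable def fixedBasis : HilbertBasis (basisIndex H) ℂ H :=
  (exists_hilbertBasis ℂ H).choose_spec.choose

/-- The trace `∑ ⟪e i, T (e i)⟫`.  It is meaningful for trace class `T`, and there it does not
depend on the orthonormal basis. -/
noncomputable def trace (T : H →L[ℂ] H) : ℂ :=
  ∑' i : basisIndex H, inner ℂ (fixedBasis H i) (T (fixedBasis H i))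

/-- Density operators (states): positive trace class operators of trace one. -/
structure IsDensity (ρ : H →L[ℂ] H) : Prop where
  nonneg : 0 ≤ ρ
  traceClass : IsTraceClass ρ
  trace_eq : trace ρ = 1

variable (H) in
/-- The quantum effects on `H`: the bounded operators `A` with `0 ≤ A ≤ I`. -/
def Effect : Type _ := {A : H →L[ℂ] H // 0 ≤ A ∧ A ≤ 1}

instance : CoeOut (Effect H) (H →L[ℂ] H) := ⟨Subtype.val⟩

/-- The strong operator topology on the effects. -/
noncomputable instance : TopologicalSpace (Effect H) :=
  TopologicalSpace.induced
    (fun A : Effect H => ContinuousLinearMap.toPointwiseConvergenceCLM ℂ (RingHom.id ℂ) H H A.1)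
    inferInstance

/-- Continuity into the effects is pointwise norm continuity on vectors. -/
theorem Effect.tendsto_iff {α : Type*} {l : Filter α} {f : α → Effect H} {A : Effect H} :
    Filter.Tendsto f l (nhds A) ↔
      ∀ x : H, Filter.Tendsto (fun a => (f a).1 x) l (nhds (A.1 x)) := by
  rw [nhds_induced, Filter.tendsto_comap_iff,
    PointwiseConvergenceCLM.tendsto_iff_forall_tendsto]
  rfl

namespace Effect

/-- The identity operator as an effect. -/
def id : Effect H := ⟨1, zero_le_one, le_rfl⟩

/-- The effect `A^{1/2} B A^{1/2}`. -/
noncomputable def standardProduct (A B : Effect H) : Effect H :=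
  ⟨CFC.sqrt (A : H →L[ℂ] H) * B * CFC.sqrt (A : H →L[ℂ] H),
    conjugate_nonneg_of_nonneg B.2.1 (CFC.sqrt_nonneg _), by
      have h := conjugate_le_conjugate_of_nonneg B.2.2 (CFC.sqrt_nonneg (A : H →L[ℂ] H))
      rw [mul_one, CFC.sqrt_mul_sqrt_self _ A.2.1] at h
      exact h.trans A.2.2⟩

/-- The effect `A²`. -/
def sq (A : Effect H) : Effect H :=
  ⟨(A : H →L[ℂ] H) ^ 2, by
      have h := conjugate_nonneg_of_nonneg (zero_le_one (α := H →L[ℂ] H)) A.2.1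
      rwa [mul_one, ← pow_two] at h, by
      have h := (standardProduct A A).2.2
      have e : (standardProduct A A).1 = A.1 ^ 2 := by
        have hs := CFC.sqrt_mul_sqrt_self A.1 A.2.1
        change CFC.sqrt A.1 * A.1 * CFC.sqrt A.1 = A.1 ^ 2
        calc CFC.sqrt A.1 * A.1 * CFC.sqrt A.1
            = CFC.sqrt A.1 * (CFC.sqrt A.1 * CFC.sqrt A.1) * CFC.sqrt A.1 := by rw [hs]
          _ = (CFC.sqrt A.1 * CFC.sqrt A.1) * (CFC.sqrt A.1 * CFC.sqrt A.1) := by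
              simp only [mul_assoc]
          _ = A.1 ^ 2 := by rw [hs, pow_two]
      rw [e] at h
      exact h⟩

end Effect

/-- Pure states: orthogonal projections of rank one. -/
def IsPureState (P : H →L[ℂ] H) : Prop :=
  IsStarProjection P ∧ Module.finrank ℂ (LinearMap.range (P : H →ₗ[ℂ] H)) = 1

/-- A density operator is an effect, so a state may be used as an argument of a binary operation
on effects, and quantifying over the effects that are density operators quantifies over all
states. -/
theorem IsDensity.le_one {ρ : H →L[ℂ] H} (h : IsDensity ρ) : ρ ≤ 1 := by
  set b := fixedBasis H
  set S := CFC.sqrt ρ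
  have hS0 : 0 ≤ S := CFC.sqrt_nonneg ρ
  have hSS : S * S = ρ := CFC.sqrt_mul_sqrt_self ρ h.nonneg
  have hsa : ∀ x y : H, inner ℂ (S x) y = inner ℂ x (S y) := fun x y =>
    (ContinuousLinearMap.nonneg_iff_isPositive S).1 hS0 |>.isSymmetric x y
  have hρ : ∀ x : H, inner ℂ x (ρ x) = ((‖S x‖ ^ 2 : ℝ) : ℂ) := by
    intro x
    rw [← hSS, mul_apply_eq_comp, ← hsa, inner_self_eq_norm_sq_to_K]
    simp
  have hsum : HasSum (fun i => ‖S (b i)‖ ^ 2) 1 := by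
    have h1 := h.traceClass _ b
    rw [CFC.abs_of_nonneg ρ h.nonneg] at h1
    have h2 := h1.hasSum
    have h3 : (∑' i, inner ℂ (b i) (ρ (b i))) = 1 := h.trace_eq
    rw [h3] at h2
    simp only [hρ] at h2
    rw [← Complex.ofReal_one] at h2
    exact Complex.hasSum_ofReal.1 h2
  rw [ContinuousLinearMap.le_def, ContinuousLinearMap.isPositive_def']
  refine ⟨?_, fun x => ?_⟩
  · exact (IsSelfAdjoint.one _).sub (IsSelfAdjoint.of_nonneg h.nonneg)
  have hx : HasSum (fun i => ‖inner ℂ (b i) (S x)‖ ^ 2) (‖S x‖ ^ 2) := by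
    have h4 := b.hasSum_inner_mul_inner (S x) (S x)
    rw [inner_self_eq_norm_sq_to_K] at h4
    have h5 : ∀ i, inner ℂ (S x) (b i) * inner ℂ (b i) (S x)
        = ((‖inner ℂ (b i) (S x)‖ ^ 2 : ℝ) : ℂ) := by
      intro i
      rw [← inner_conj_symm (S x) (b i), RCLike.conj_mul]
      simp
    simp only [h5] at h4
    have h7 : (((‖S x‖ : ℝ) : ℂ)) ^ 2 = ((‖S x‖ ^ 2 : ℝ) : ℂ) := by push_cast; rfl
    erw [h7] at h4
    exact Complex.hasSum_ofReal.1 h4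
  have hle : ‖S x‖ ^ 2 ≤ 1 * ‖x‖ ^ 2 := by
    refine hasSum_le (fun i => ?_) hx (hsum.mul_right (‖x‖ ^ 2))
    rw [← hsa, ← mul_pow]
    exact pow_le_pow_left₀ (norm_nonneg _) (norm_inner_le_norm _ _) 2
  rw [ContinuousLinearMap.reApplyInnerSelf_apply, sub_apply, inner_sub_left,
    ← inner_conj_symm (ρ x) x, hρ x]
  simp only [one_apply_eq_self, inner_self_eq_norm_sq_to_K, map_sub,
    RCLike.conj_re]
  have : (RCLike.re (((‖x‖ : ℝ) : ℂ) ^ 2) : ℝ) = ‖x‖ ^ 2 := by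
    rw [← Complex.ofReal_pow]; exact Complex.ofReal_re _
  have h6 : RCLike.re (((‖S x‖ ^ 2 : ℝ) : ℂ)) = ‖S x‖ ^ 2 := Complex.ofReal_re _
  erw [this, h6]
  linarith

/-- A sequential product on the effects of `H`. -/
structure IsSequentialProduct (op : Effect H → Effect H → Effect H) : Prop where
  /-- Duality: `Tr ((A ∘ ρ) B) = Tr (ρ (A ∘ B))` for all states `ρ` and effects `A`, `B`.  Both
  traces are required to make sense. -/
  duality : ∀ A B ρ : Effect H, IsDensity (ρ : H →L[ℂ] H) →
    IsTraceClass ((op A ρ : H →L[ℂ] H) * (B : H →L[ℂ] H)) ∧ IsTraceClass ((ρ : H →L[ℂ] H) * (op A B : H →L[ℂ] H)) ∧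
      trace ((op A ρ : H →L[ℂ] H) * (B : H →L[ℂ] H)) = trace ((ρ : H →L[ℂ] H) * (op A B : H →L[ℂ] H))
  /-- Unit: `A ∘ I = I ∘ A = A`. -/
  unit : ∀ A : Effect H, op A Effect.id = A ∧ op Effect.id A = A
  /-- Weak associativity: `A² ∘ B = A ∘ (A ∘ B)`. -/
  weak_assoc : ∀ A B : Effect H, op A.sq B = op A (op A B)
  /-- Continuity in the first variable for the strong operator topology. -/
  continuous : ∀ B : Effect H, Continuous fun A : Effect H => op A B
  /-- Purity: if `P` is a pure state and `A ∘ P ≠ 0`, then `A ∘ P` divided by its trace is a pure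
  state. -/
  purity : ∀ A P : Effect H, IsPureState (P : H →L[ℂ] H) → (op A P : H →L[ℂ] H) ≠ 0 →
    IsPureState ((trace (op A P : H →L[ℂ] H))⁻¹ • (op A P : H →L[ℂ] H))

end QuantumEffects

namespace QuantumEffects

open InnerProductSpace Filter Topology ComplexOrder

set_option linter.unusedSectionVars false

variable {H : Type*} [NormedAddCommGroup H] [InnerProductSpace ℂ H] [CompleteSpace H]

/-! For a sequential product, purity gives `A ∘ P_z = |u⟩⟨u|` for each unit vector `z`, and duality
turns this into `⟨z, (A ∘ B) z⟩ = ⟨u, B u⟩` for all `B`. By scaling, every `y` has such a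
representing vector `g`, and `B = I` gives `⟨y, A y⟩ = ‖g‖²`. Weak associativity then reads `⟨y, (A²
∘ P_z) y⟩ = |⟨u, g⟩|²`.

The crux is `IsSequentialProduct.inner_apply_eq_zero`. If the transition probability between `z` and
`w` under `A²` vanishes, their vectors `u`, `v` are orthogonal. For `y = z + s w`, Bessel's
inequality gives `‖g‖² ≥ ‖u‖² + |s|²‖v‖²`, whereas `‖g‖² = ⟨y, A y⟩` contains the cross term `2 Re
(s ⟨z, A w⟩)`. A choice of `s` making this term negative forces `⟨z, A w⟩ = 0`.

Hence, if `A² ∘ P_w = |s⟩⟨s|`, everything orthogonal to `s` is orthogonal to `A w`. So `A w` is a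
multiple of `s`, of the same norm by the unit law, and `A² ∘ B = A B A` by polarization
(`IsSequentialProduct.op_sq`). Replacing `A` by its square root finishes this direction.

Conversely, duality for `A^{1/2} B A^{1/2}` is cyclicity of the trace for products of
Hilbert-Schmidt operators, and continuity is strong continuity of the square root on effects. -/

/-! ### Hilbert-Schmidt operators and cyclicity of the trace -/

theorem inner_apply_left (T : H →L[ℂ] H) (x y : H) : inner ℂ (T x) y = inner ℂ x (star T y) := by
  rw [ContinuousLinearMap.star_eq_adjoint, ContinuousLinearMap.adjoint_inner_right]

theorem inner_apply_right (T : H →L[ℂ] H) (x y : H) : inner ℂ x (T y) = inner ℂ (star T x) y := by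
  rw [ContinuousLinearMap.star_eq_adjoint, ContinuousLinearMap.adjoint_inner_left]

/-- Parseval's identity for the squared norm. -/
theorem hasSum_norm_inner_sq {ι : Type*} (b : HilbertBasis ι ℂ H) (x : H) :
    HasSum (fun i => ‖inner ℂ (b i) x‖ ^ 2) (‖x‖ ^ 2) := by
  have h := b.hasSum_inner_mul_inner x x
  have h1 : ∀ i, inner ℂ x (b i) * inner ℂ (b i) x = ((‖inner ℂ (b i) x‖ ^ 2 : ℝ) : ℂ) := by
    intro i
    rw [← inner_conj_symm x (b i), RCLike.conj_mul]
    simp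
  have h2 : inner ℂ x x = ((‖x‖ ^ 2 : ℝ) : ℂ) := by
    rw [inner_self_eq_norm_sq_to_K]; simp
  simp only [h1, h2] at h
  exact Complex.hasSum_ofReal.1 h

/-- Hilbert-Schmidt operators. -/
def IsHilbertSchmidt (X : H →L[ℂ] H) : Prop :=
  ∀ (w : Set H) (b : HilbertBasis w ℂ H), Summable fun i : w => ‖X (b i)‖ ^ 2

theorem summable_norm_inner_sq_prod {ι κ : Type*} (b : HilbertBasis ι ℂ H)
    (c : HilbertBasis κ ℂ H) {X : H →L[ℂ] H} (h : Summable fun i => ‖X (b i)‖ ^ 2) :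
    Summable fun p : ι × κ => ‖inner ℂ (c p.2) (X (b p.1))‖ ^ 2 := by
  refine (summable_prod_of_nonneg (fun _ => sq_nonneg _)).2
    ⟨fun i => (hasSum_norm_inner_sq c (X (b i))).summable, ?_⟩
  exact h.congr fun i => (hasSum_norm_inner_sq c (X (b i))).tsum_eq.symm

/-- The matrix entries are square summable over pairs of indices, and the adjoint only swaps the two
indices. -/
theorem IsHilbertSchmidt.star {X : H →L[ℂ] H} (h : IsHilbertSchmidt X) :
    IsHilbertSchmidt (star X) := by
  intro w b
  have h1 : Summable fun p : w × w => ‖inner ℂ (b p.1) (X (b p.2))‖ ^ 2 :=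
    (summable_norm_inner_sq_prod b b (h w b)).prod_symm
  have h2 : Summable fun i : w => ∑' j, ‖inner ℂ (b i) (X (b j))‖ ^ 2 := h1.prod
  refine h2.congr fun i => ?_
  rw [← (hasSum_norm_inner_sq b _).tsum_eq]
  refine tsum_congr fun j => ?_
  rw [inner_apply_right X, norm_inner_symm]

theorem IsHilbertSchmidt.mul_left {X : H →L[ℂ] H} (h : IsHilbertSchmidt X) (Y : H →L[ℂ] H) :
    IsHilbertSchmidt (Y * X) := by
  intro w b
  refine Summable.of_nonneg_of_le (fun _ => by positivity) (fun i => ?_)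
    ((h w b).mul_left (‖Y‖ ^ 2))
  rw [← mul_pow]
  exact pow_le_pow_left₀ (norm_nonneg _) (Y.le_opNorm _) 2

theorem IsHilbertSchmidt.mul_right {X : H →L[ℂ] H} (h : IsHilbertSchmidt X) (Y : H →L[ℂ] H) :
    IsHilbertSchmidt (X * Y) := by
  simpa using (h.star.mul_left (Star.star Y)).star

theorem isHilbertSchmidt_sqrt {ρ : H →L[ℂ] H} (h0 : 0 ≤ ρ) (h : IsTraceClass ρ) :
    IsHilbertSchmidt (CFC.sqrt ρ) := by
  intro w b
  have h1 := h w b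
  rw [CFC.abs_of_nonneg ρ h0] at h1
  rw [← Complex.summable_ofReal]
  refine h1.congr fun i => ?_
  conv_lhs => rw [← CFC.sqrt_mul_sqrt_self ρ h0]
  rw [mul_apply_eq_comp, inner_apply_right,
    (IsSelfAdjoint.of_nonneg (CFC.sqrt_nonneg ρ)).star_eq, inner_self_eq_norm_sq_to_K]
  simp

/-- `|T| = W T` for a bounded operator `W`. -/
theorem exists_mul_eq_abs (T : H →L[ℂ] H) : ∃ W : H →L[ℂ] H, W * T = CFC.abs T := by
  have hn : ∀ x, ‖CFC.abs T x‖ = ‖T x‖ := by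
    intro x
    have h : (inner ℂ (CFC.abs T x) (CFC.abs T x)) = inner ℂ (T x) (T x) := by
      rw [inner_apply_left, inner_apply_left, (CFC.abs_nonneg T).isSelfAdjoint.star_eq,
        ← mul_apply_eq_comp, ← mul_apply_eq_comp, CFC.abs_mul_abs]
    rw [inner_self_eq_norm_sq_to_K, inner_self_eq_norm_sq_to_K] at h
    have h' : ‖CFC.abs T x‖ ^ 2 = ‖T x‖ ^ 2 := by exact_mod_cast h
    exact (sq_eq_sq₀ (norm_nonneg _) (norm_nonneg _)).1 h'
  -- Since `|T| x` and `T x` have equal norms, `T x ↦ |T| x` is well defined and isometric. It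
  -- extends to the closure of the range, and `W` is that extension after the orthogonal projection.
  set K := (LinearMap.range (T : H →ₗ[ℂ] H)).topologicalClosure
  have hK : ∀ x, (T : H →ₗ[ℂ] H) x ∈ K := fun x =>
    Submodule.le_topologicalClosure _ (LinearMap.mem_range_self _ x)
  set e : H →ₗ[ℂ] K := (T : H →ₗ[ℂ] H).codRestrict K hK
  have hd : DenseRange e := by
    refine Subtype.dense_iff.2 fun y hy => ?_
    refine closure_mono ?_ hy
    rintro _ ⟨x, rfl⟩
    exact ⟨e x, ⟨x, rfl⟩, rfl⟩
  have hb : ∀ x, ‖(CFC.abs T).toLinearMap x‖ ≤ 1 * ‖e x‖ := fun x => by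
    rw [one_mul]; exact (hn x).le
  refine ⟨(LinearMap.extendOfNorm (CFC.abs T).toLinearMap e).comp K.orthogonalProjectionOnto, ?_⟩
  ext x
  have h1 : K.orthogonalProjectionOnto (T x) = e x :=
    K.orthogonalProjectionOnto_mem_subspace_eq_self (e x)
  rw [mul_apply_eq_comp, ContinuousLinearMap.comp_apply, h1,
    LinearMap.extendOfNorm_eq hd ⟨1, hb⟩]
  rfl

/-- With `|XY| = W X Y`, each diagonal entry is `⟨(W X)⋆ e, Y e⟩`, dominated by the sum of the two
squared norms. -/
theorem IsHilbertSchmidt.isTraceClass_mul {X Y : H →L[ℂ] H} (hX : IsHilbertSchmidt X)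
    (hY : IsHilbertSchmidt Y) : IsTraceClass (X * Y) := by
  intro w b
  obtain ⟨W, hW⟩ := exists_mul_eq_abs (X * Y)
  have h1 := (hX.mul_left W).star w b
  refine Summable.of_norm_bounded (h1.add (hY w b)) fun i => ?_
  rw [← hW, ← mul_assoc, mul_apply_eq_comp, inner_apply_right]
  refine (norm_inner_le_norm _ _).trans ?_
  nlinarith [sq_nonneg (‖Star.star (W * X) (b i)‖ - ‖Y (b i)‖),
    sq_nonneg (‖Star.star (W * X) (b i)‖), sq_nonneg ‖Y (b i)‖]

/-- Both traces are iterated sums of one absolutely summable double family, taken in opposite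
orders. -/
theorem IsHilbertSchmidt.trace_mul_comm {X Y : H →L[ℂ] H} (hX : IsHilbertSchmidt X)
    (hY : IsHilbertSchmidt Y) : trace (X * Y) = trace (Y * X) := by
  set b := fixedBasis H
  set f : basisIndex H × basisIndex H → ℂ :=
    fun p => inner ℂ (b p.1) (X (b p.2)) * inner ℂ (b p.2) (Y (b p.1)) with hf
  have key : ∀ (X Y : H →L[ℂ] H) (i : basisIndex H), inner ℂ (b i) ((X * Y) (b i)) =
      ∑' j, inner ℂ (b i) (X (b j)) * inner ℂ (b j) (Y (b i)) := by
    intro X Y i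
    rw [mul_apply_eq_comp, inner_apply_right, ← (b.hasSum_inner_mul_inner _ _).tsum_eq]
    exact tsum_congr fun j => by rw [inner_apply_right X]
  have hs : Summable f := by
    refine Summable.of_norm_bounded ((summable_norm_inner_sq_prod b b (hX _ b)).prod_symm.add
      (summable_norm_inner_sq_prod b b (hY _ b))) fun p => ?_
    simp only [hf, norm_mul, Prod.swap]
    nlinarith [sq_nonneg (‖inner ℂ (b p.1) (X (b p.2))‖ - ‖inner ℂ (b p.2) (Y (b p.1))‖),
      sq_nonneg (‖inner ℂ (b p.1) (X (b p.2))‖), sq_nonneg ‖inner ℂ (b p.2) (Y (b p.1))‖]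
  unfold trace
  rw [tsum_congr (key X Y), tsum_congr (key Y X)]
  have h1 : ∑' i, ∑' j, f (i, j) = ∑' j, ∑' i, f (i, j) :=
    (Summable.tsum_comm (f := fun i j => f (i, j)) hs).symm
  refine h1.trans ?_
  exact tsum_congr fun j => tsum_congr fun i => mul_comm _ _

/-! ### Rank-one operators, pure states and bounds on effects -/

theorem trace_rankOne (x y : H) : trace (rankOne ℂ x y) = inner ℂ y x := by
  unfold trace
  rw [← ((fixedBasis H).hasSum_inner_mul_inner y x).tsum_eq]
  exact tsum_congr fun i => by rw [rankOne_apply, inner_smul_right]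

theorem isPureState_rankOne {x : H} (hx : ‖x‖ = 1) : IsPureState (rankOne ℂ x x) := by
  refine ⟨isStarProjection_rankOne_self hx, ?_⟩
  have hx0 : x ≠ 0 := by rintro rfl; simp at hx
  have : LinearMap.range ((rankOne ℂ x x : H →L[ℂ] H) : H →ₗ[ℂ] H) = Submodule.span ℂ {x} := by
    ext y
    simp only [LinearMap.mem_range, Submodule.mem_span_singleton, ContinuousLinearMap.coe_coe,
      rankOne_apply]
    refine ⟨fun ⟨z, hz⟩ => ⟨_, hz⟩, fun ⟨a, ha⟩ => ⟨a • x, ?_⟩⟩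
    rw [inner_smul_right, inner_self_eq_norm_sq_to_K, hx, ← ha]
    simp
  rw [this, finrank_span_singleton hx0]

theorem IsPureState.exists_eq_rankOne {P : H →L[ℂ] H} (h : IsPureState P) :
    ∃ x : H, ‖x‖ = 1 ∧ P = rankOne ℂ x x := by
  obtain ⟨⟨v, hv⟩, hv0, hspan⟩ := finrank_eq_one_iff'.1 h.2
  have hv0' : v ≠ 0 := fun h => hv0 (Subtype.ext h)
  set x : H := ((‖v‖⁻¹ : ℝ) : ℂ) • v with hx
  have hx1 : ‖x‖ = 1 := by
    rw [hx, norm_smul, Complex.norm_real, norm_inv, norm_norm, inv_mul_cancel₀]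
    exact norm_ne_zero_iff.2 hv0'
  have hvx : v = ((‖v‖ : ℝ) : ℂ) • x := by
    rw [hx, smul_smul, ← Complex.ofReal_mul, mul_inv_cancel₀ (norm_ne_zero_iff.2 hv0')]
    simp
  have hPP : ∀ y, P (P y) = P y := fun y => by
    rw [← mul_apply_eq_comp, h.1.isIdempotentElem.eq]
  have hPx : P x = x := by
    obtain ⟨y, hy⟩ := hv
    have hy' : P y = v := hy
    rw [hx, map_smul, ← hy', hPP]
  refine ⟨x, hx1, ?_⟩
  ext y
  obtain ⟨c, hc⟩ := hspan ⟨P y, ⟨y, rfl⟩⟩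
  have hc' : c • v = P y := congrArg Subtype.val hc
  have h1 : P y = (c * ((‖v‖ : ℝ) : ℂ)) • x := by rw [← hc', mul_smul, ← hvx]
  have h2 : inner ℂ x (P y) = inner ℂ x y := by
    rw [inner_apply_right, h.1.isSelfAdjoint.star_eq, hPx]
  rw [rankOne_apply, ← h2, h1, inner_smul_right, inner_self_eq_norm_sq_to_K, hx1]
  simp

theorem isTraceClass_of_nonneg {ρ : H →L[ℂ] H} (h0 : 0 ≤ ρ)
    (h : ∀ (w : Set H) (b : HilbertBasis w ℂ H), Summable fun i : w => inner ℂ (b i) (ρ (b i))) :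
    IsTraceClass ρ := by
  intro w b
  rw [CFC.abs_of_nonneg ρ h0]
  exact h w b

theorem rankOne_self_nonneg (x : H) : (0 : H →L[ℂ] H) ≤ rankOne ℂ x x :=
  (ContinuousLinearMap.nonneg_iff_isPositive _).2 (isPositive_rankOne_self x)

theorem isDensity_rankOne {x : H} (hx : ‖x‖ = 1) : IsDensity (rankOne ℂ x x : H →L[ℂ] H) where
  nonneg := rankOne_self_nonneg x
  traceClass := by
    refine isTraceClass_of_nonneg (rankOne_self_nonneg x) fun w b => ?_
    refine (b.hasSum_inner_mul_inner x x).summable.congr fun i => ?_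
    rw [rankOne_apply, inner_smul_right]
  trace_eq := by
    rw [trace_rankOne, inner_self_eq_norm_sq_to_K, hx]; simp

theorem Effect.norm_le_one (A : Effect H) : ‖A.1‖ ≤ 1 :=
  (CStarAlgebra.norm_le_one_iff_of_nonneg A.1 A.2.1).2 A.2.2

theorem Effect.isSelfAdjoint (A : Effect H) : IsSelfAdjoint A.1 :=
  IsSelfAdjoint.of_nonneg A.2.1

theorem Effect.isSelfAdjoint_sqrt (A : Effect H) : IsSelfAdjoint (CFC.sqrt A.1) :=
  IsSelfAdjoint.of_nonneg (CFC.sqrt_nonneg A.1)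

theorem Effect.norm_sqrt_le_one (A : Effect H) : ‖CFC.sqrt A.1‖ ≤ 1 := by
  have h : ‖CFC.sqrt A.1‖ * ‖CFC.sqrt A.1‖ ≤ 1 := by
    rw [← CStarRing.norm_star_mul_self, A.isSelfAdjoint_sqrt.star_eq,
      CFC.sqrt_mul_sqrt_self _ A.2.1]
    exact A.norm_le_one
  nlinarith [norm_nonneg (CFC.sqrt A.1)]

theorem sandwich_rankOne {S : H →L[ℂ] H} (hS : IsSelfAdjoint S) (x : H) :
    S * rankOne ℂ x x * S = rankOne ℂ (S x) (S x) := by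
  ext y
  simp only [mul_apply_eq_comp, rankOne_apply, map_smul]
  rw [inner_apply_right, hS.star_eq]

/-! ### Strong continuity of the square root -/

/-- Products of uniformly bounded strongly convergent families converge strongly. -/
theorem tendsto_mul_apply {α : Type*} {l : Filter α} {S T : α → H →L[ℂ] H} {S₀ T₀ : H →L[ℂ] H}
    {C : ℝ} (hC : ∀ a, ‖S a‖ ≤ C) (hS : ∀ x, Tendsto (fun a => S a x) l (𝓝 (S₀ x)))
    (hT : ∀ x, Tendsto (fun a => T a x) l (𝓝 (T₀ x))) (x : H) :
    Tendsto (fun a => (S a * T a) x) l (𝓝 ((S₀ * T₀) x)) := by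
  have h1 : Tendsto (fun a => S a (T a x - T₀ x)) l (𝓝 0) := by
    refine squeeze_zero_norm (a := fun a => C * ‖T a x - T₀ x‖)
      (fun a => (S a).le_of_opNorm_le (hC a) _) ?_
    have := (tendsto_iff_norm_sub_tendsto_zero.1 (hT x)).const_mul C
    simpa using this
  have h2 := h1.add (hS (T₀ x))
  simpa [mul_apply_eq_comp] using h2

theorem tendsto_aeval_apply {α : Type*} {l : Filter α} {f : α → Effect H} {A : Effect H}
    (h : Tendsto f l (𝓝 A)) (p : Polynomial ℝ) (x : H) :
    Tendsto (fun a => Polynomial.aeval (f a).1 p x) l (𝓝 (Polynomial.aeval A.1 p x)) := by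
  have hpow : ∀ (n : ℕ) (x : H), Tendsto (fun a => ((f a).1 ^ n) x) l (𝓝 ((A.1 ^ n) x)) := by
    intro n
    induction n with
    | zero => intro x; simpa using tendsto_const_nhds
    | succ n ih =>
      intro x
      simp only [pow_succ']
      exact tendsto_mul_apply (fun a => (f a).norm_le_one) (Effect.tendsto_iff.1 h) ih x
  simp only [Polynomial.aeval_eq_sum_range, sum_apply, smul_apply]
  exact tendsto_finsetSum _ fun n _ => (hpow n x).const_smul _

/-- The spectrum of every effect lies in `[0, 1]`, so one polynomial approximates the square roots
of all effects uniformly in norm. This uniformity transfers strong continuity from polynomials to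
the square root. -/
theorem norm_aeval_sub_sqrt_le {p : Polynomial ℝ} {ε : ℝ} (hε : 0 ≤ ε)
    (hp : ∀ t ∈ Set.Icc (0 : ℝ) 1, |p.eval t - Real.sqrt t| < ε) (A : Effect H) :
    ‖Polynomial.aeval A.1 p - CFC.sqrt A.1‖ ≤ ε := by
  have hA := A.isSelfAdjoint
  rw [CFC.sqrt_eq_real_sqrt A.1 A.2.1, cfcₙ_eq_cfc, ← cfc_polynomial p A.1 hA,
    ← cfc_sub _ _ A.1]
  refine norm_cfc_le hε fun t ht => ?_
  have ht0 : 0 ≤ t := spectrum_nonneg_of_nonneg A.2.1 ht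
  have ht1 : t ≤ 1 :=
    ((le_abs_self t).trans (spectrum.norm_le_norm_mul_of_mem ht)).trans
      (mul_le_one₀ A.norm_le_one (norm_nonneg _) ContinuousLinearMap.norm_id_le)
  exact (hp t ⟨ht0, ht1⟩).le

/-- The square root is continuous on the effects in the strong operator topology. -/
theorem tendsto_sqrt_apply {α : Type*} {l : Filter α} {f : α → Effect H} {A : Effect H}
    (h : Tendsto f l (𝓝 A)) (x : H) :
    Tendsto (fun a => CFC.sqrt (f a).1 x) l (𝓝 (CFC.sqrt A.1 x)) := by
  rw [Metric.tendsto_nhds]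
  intro ε hε
  -- The summand `1` keeps the denominator nonzero when `x = 0`.
  set δ := ε / (3 * (‖x‖ + 1)) with hδ
  have hδ0 : 0 < δ := by positivity
  have hδx : δ * ‖x‖ ≤ ε / 3 := by
    have h1 : δ * (‖x‖ + 1) = ε / 3 := by rw [hδ]; field_simp
    nlinarith
  obtain ⟨p, hp⟩ := exists_polynomial_near_of_continuousOn 0 1 Real.sqrt
    Real.continuous_sqrt.continuousOn δ hδ0
  have hnear : ∀ B : Effect H, dist (Polynomial.aeval B.1 p x) (CFC.sqrt B.1 x) ≤ ε / 3 := by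
    intro B
    rw [dist_eq_norm, ← sub_apply]
    exact ((ContinuousLinearMap.le_of_opNorm_le _
      (norm_aeval_sub_sqrt_le hδ0.le hp B) x)).trans hδx
  filter_upwards [(Metric.tendsto_nhds.1 (tendsto_aeval_apply h p x)) (ε / 3) (by positivity)]
    with a ha
  have h1 := hnear (f a)
  have h2 := hnear A
  rw [dist_comm] at h1
  linarith [dist_triangle4 (CFC.sqrt (f a).1 x) (Polynomial.aeval (f a).1 p x)
    (Polynomial.aeval A.1 p x) (CFC.sqrt A.1 x)]

theorem continuous_standardProduct (B : Effect H) :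
    Continuous fun A : Effect H => Effect.standardProduct A B := by
  refine continuous_iff_continuousAt.2 fun A => Effect.tendsto_iff.2 fun x => ?_
  have hs := fun x => tendsto_sqrt_apply (tendsto_id (x := 𝓝 A)) x
  refine tendsto_mul_apply (S := fun A : Effect H => CFC.sqrt A.1 * B.1)
    (S₀ := CFC.sqrt A.1 * B.1) (C := 1) (fun A => ?_)
    (tendsto_mul_apply (fun A => A.norm_sqrt_le_one) hs fun x => tendsto_const_nhds) hs x
  calc ‖CFC.sqrt A.1 * B.1‖ ≤ ‖CFC.sqrt A.1‖ * ‖B.1‖ := norm_mul_le _ _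
    _ ≤ 1 * 1 := by
      gcongr
      exacts [A.norm_sqrt_le_one, B.norm_le_one]
    _ = 1 := one_mul 1

/-! ### The standard product is a sequential product -/

theorem isSequentialProduct_standardProduct :
    IsSequentialProduct (Effect.standardProduct : Effect H → Effect H → Effect H) where
  duality A B ρ hρ := by
    set R := CFC.sqrt A.1
    set S := CFC.sqrt ρ.1
    have hS : IsHilbertSchmidt S := isHilbertSchmidt_sqrt hρ.nonneg hρ.traceClass
    have hSS : S * S = ρ.1 := CFC.sqrt_mul_sqrt_self _ ρ.2.1
    -- Splitting `ρ = S S` puts a Hilbert-Schmidt factor on each side. After commuting, both traces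
    -- become that of `S R B R S`.
    have h1 : (Effect.standardProduct A ρ).1 * B.1 = (R * S) * (S * (R * B.1)) := by
      change R * ρ.1 * R * B.1 = _
      rw [← hSS]; simp only [mul_assoc]
    have h2 : ρ.1 * (Effect.standardProduct A B).1 = S * (S * (R * B.1 * R)) := by
      change ρ.1 * (R * B.1 * R) = _
      rw [← hSS]; simp only [mul_assoc]
    have hX := hS.mul_left R
    have hY := hS.mul_right (R * B.1)
    have hZ := hS.mul_right (R * B.1 * R)
    rw [h1, h2]
    refine ⟨hX.isTraceClass_mul hY, hS.isTraceClass_mul hZ, ?_⟩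
    rw [hX.trace_mul_comm hY, hS.trace_mul_comm hZ]
    simp only [mul_assoc]
  unit A := by
    refine ⟨Subtype.ext ?_, Subtype.ext ?_⟩
    · change CFC.sqrt A.1 * 1 * CFC.sqrt A.1 = A.1
      rw [mul_one, CFC.sqrt_mul_sqrt_self _ A.2.1]
    · change CFC.sqrt 1 * A.1 * CFC.sqrt 1 = A.1
      rw [CFC.sqrt_one, one_mul, mul_one]
  weak_assoc A B := by
    refine Subtype.ext ?_
    change CFC.sqrt (A.1 ^ 2) * B.1 * CFC.sqrt (A.1 ^ 2) =
      CFC.sqrt A.1 * (CFC.sqrt A.1 * B.1 * CFC.sqrt A.1) * CFC.sqrt A.1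
    rw [CFC.sqrt_sq A.1 A.2.1]
    conv_lhs => rw [← CFC.sqrt_mul_sqrt_self A.1 A.2.1]
    simp only [mul_assoc]
  continuous := continuous_standardProduct
  purity A P hP h0 := by
    obtain ⟨x, -, hPx⟩ := hP.exists_eq_rankOne
    set u := CFC.sqrt A.1 x
    have h1 : (Effect.standardProduct A P).1 = rankOne ℂ u u := by
      change CFC.sqrt A.1 * P.1 * CFC.sqrt A.1 = _
      rw [hPx, sandwich_rankOne A.isSelfAdjoint_sqrt]
    rw [h1] at h0 ⊢
    have hu : u ≠ 0 := by rintro hu; simp [hu] at h0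
    have hn : ‖u‖ ≠ 0 := norm_ne_zero_iff.2 hu
    have h2 : (trace (rankOne ℂ u u))⁻¹ • rankOne ℂ u u =
        rankOne ℂ (((‖u‖⁻¹ : ℝ) : ℂ) • u) (((‖u‖⁻¹ : ℝ) : ℂ) • u) := by
      ext y
      rw [trace_rankOne, inner_self_eq_norm_sq_to_K]
      simp only [smul_apply, rankOne_apply, inner_smul_left, smul_smul]
      congr 1
      simp only [Complex.conj_ofReal, Complex.coe_algebraMap]
      push_cast
      ring
    rw [h2]
    refine isPureState_rankOne ?_
    rw [norm_smul, Complex.norm_real, norm_inv, norm_norm, inv_mul_cancel₀ hn]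

/-! ### Vectors representing a sequential product -/

theorem exists_unit_smul {x : H} (hx : x ≠ 0) :
    ∃ (r : ℝ) (e : H), r ≠ 0 ∧ ‖e‖ = 1 ∧ x = (r : ℂ) • e := by
  have hn : ‖x‖ ≠ 0 := norm_ne_zero_iff.2 hx
  refine ⟨‖x‖, ((‖x‖⁻¹ : ℝ) : ℂ) • x, hn, ?_, ?_⟩
  · rw [norm_smul, Complex.norm_real, norm_inv, norm_norm, inv_mul_cancel₀ hn]
  · rw [smul_smul, ← Complex.ofReal_mul, mul_inv_cancel₀ hn]
    simp

theorem trace_mul_rankOne_self (T : H →L[ℂ] H) (x : H) :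
    trace (rankOne ℂ x x * T) = inner ℂ x (T x) := by
  have h : rankOne ℂ x x * T = rankOne ℂ x (star T x) := by
    ext y
    simp only [mul_apply_eq_comp, rankOne_apply]
    rw [inner_apply_right]
  rw [h, trace_rankOne, inner_apply_right]

/-- The effect given by a rank one projection. -/
noncomputable def pureEffect (x : H) (hx : ‖x‖ = 1) : Effect H :=
  ⟨rankOne ℂ x x, rankOne_self_nonneg x, (isDensity_rankOne hx).le_one⟩

theorem IsSequentialProduct.exists_op_pureEffect {op : Effect H → Effect H → Effect H}
    (h : IsSequentialProduct op) (A : Effect H) {x : H} (hx : ‖x‖ = 1) :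
    ∃ u : H, (op A (pureEffect x hx)).1 = rankOne ℂ u u := by
  set Q := op A (pureEffect x hx) with hQ
  by_cases h0 : Q.1 = 0
  · exact ⟨0, by rw [h0]; simp⟩
  obtain ⟨e, he, hPe⟩ := (h.purity A (pureEffect x hx) (isPureState_rankOne hx) h0).exists_eq_rankOne
  set c := trace Q.1
  have he0 : e ≠ 0 := by rintro rfl; simp at he
  -- With trace `0` the inverse would default to `0`, and purity would make the zero operator a
  -- rank-one projection.
  have hc : c ≠ 0 := by
    intro hc
    have h1 : (0 : H →L[ℂ] H) = rankOne ℂ e e := by rw [← hPe, ← hQ, hc, inv_zero, zero_smul]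
    exact rankOne_ne_zero he0 he0 h1.symm
  have h1 : Q.1 = c • rankOne ℂ e e := by rw [← hPe, smul_smul, mul_inv_cancel₀ hc, one_smul]
  have h2 : inner ℂ e (Q.1 e) = c := by
    rw [h1, smul_apply, rankOne_apply, inner_smul_right, inner_smul_right,
      inner_self_eq_norm_sq_to_K, he]
    simp
  -- Positivity of `c` lets its square root be absorbed into the vector.
  have h3 : 0 ≤ c := by
    rw [← h2]
    exact ((ContinuousLinearMap.nonneg_iff_isPositive _).1 Q.2.1).inner_nonneg_right e
  obtain ⟨r, hr, hrc⟩ := RCLike.nonneg_iff_exists_ofReal.1 h3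
  refine ⟨((Real.sqrt r : ℝ) : ℂ) • e, ?_⟩
  rw [h1]
  ext y
  simp only [smul_apply, rankOne_apply, inner_smul_left, smul_smul, Complex.conj_ofReal]
  congr 1
  have h4 : ((Real.sqrt r : ℝ) : ℂ) * ((Real.sqrt r : ℝ) : ℂ) = c := by
    rw [← Complex.ofReal_mul, Real.mul_self_sqrt hr]; exact hrc
  rw [← h4]; ring

theorem IsSequentialProduct.inner_op {op : Effect H → Effect H → Effect H}
    (h : IsSequentialProduct op) {A : Effect H} {x : H} (hx : ‖x‖ = 1) {u : H}
    (hu : (op A (pureEffect x hx)).1 = rankOne ℂ u u) (B : Effect H) :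
    inner ℂ x ((op A B).1 x) = inner ℂ u (B.1 u) := by
  have h1 := (h.duality A B (pureEffect x hx) (isDensity_rankOne hx)).2.2
  rw [hu, trace_mul_rankOne_self] at h1
  rw [h1]
  exact (trace_mul_rankOne_self _ _).symm

theorem IsSequentialProduct.exists_inner_op {op : Effect H → Effect H → Effect H}
    (h : IsSequentialProduct op) (A : Effect H) (x : H) :
    ∃ u : H, ∀ B : Effect H, inner ℂ x ((op A B).1 x) = inner ℂ u (B.1 u) := by
  by_cases hx0 : x = 0
  · exact ⟨0, fun B => by simp [hx0]⟩
  obtain ⟨r, e, -, he, rfl⟩ := exists_unit_smul hx0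
  obtain ⟨u, hu⟩ := h.exists_op_pureEffect A he
  refine ⟨(r : ℂ) • u, fun B => ?_⟩
  simp only [map_smul, inner_smul_left, inner_smul_right, h.inner_op he hu B]

theorem exists_coeff_of_norm_inner_eq {u g : H} {t : ℝ} (hu : ‖inner ℂ u g‖ = t * ‖u‖ ^ 2) :
    ∃ a : ℂ, inner ℂ u g = a * inner ℂ u u ∧ ‖a • u‖ ^ 2 = t ^ 2 * ‖u‖ ^ 2 := by
  by_cases hu0 : u = 0
  · exact ⟨0, by simp [hu0], by simp [hu0]⟩
  have hne : (inner ℂ u u : ℂ) ≠ 0 := inner_self_ne_zero.2 hu0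
  have hn : ‖(inner ℂ u u : ℂ)‖ = ‖u‖ ^ 2 := by
    rw [inner_self_eq_norm_sq_to_K]; simp
  have hp : ‖u‖ ≠ 0 := norm_ne_zero_iff.2 hu0
  refine ⟨inner ℂ u g / inner ℂ u u, (div_mul_cancel₀ _ hne).symm, ?_⟩
  rw [norm_smul, norm_div, hu, hn, mul_div_assoc, div_self (pow_ne_zero 2 hp), mul_one, mul_pow]

/-- A form of Bessel's inequality for two orthogonal vectors. -/
theorem norm_sq_add_le_of_inner_eq {u v g : H} {t : ℝ} (huv : inner ℂ u v = 0)
    (hu : ‖inner ℂ u g‖ = ‖u‖ ^ 2) (hv : ‖inner ℂ v g‖ = t * ‖v‖ ^ 2) :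
    ‖u‖ ^ 2 + t ^ 2 * ‖v‖ ^ 2 ≤ ‖g‖ ^ 2 := by
  obtain ⟨a, ha, ha'⟩ := exists_coeff_of_norm_inner_eq (t := 1) (by rw [hu, one_mul])
  obtain ⟨b, hb, hb'⟩ := exists_coeff_of_norm_inner_eq hv
  have hvu : inner ℂ v u = 0 := inner_eq_zero_symm.1 huv
  -- The vector `a • u + b • v` is the orthogonal projection of `g` onto the span of `u` and `v`.
  have h1 : inner ℂ (a • u + b • v) g = inner ℂ (a • u + b • v) (a • u + b • v) := by
    simp only [inner_add_left, inner_add_right, inner_smul_left, inner_smul_right, ha, hb, huv,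
      hvu]
    ring
  have h2 : ‖a • u + b • v‖ ^ 2 = ‖u‖ ^ 2 + t ^ 2 * ‖v‖ ^ 2 := by
    have h3 : inner ℂ (a • u) (b • v) = 0 := by rw [inner_smul_left, inner_smul_right, huv]; simp
    have h4 := norm_add_sq_eq_norm_sq_add_norm_sq_of_inner_eq_zero _ _ h3
    rw [pow_two, h4, ← pow_two, ← pow_two, ha', hb']
    ring
  have h5 := norm_inner_le_norm (𝕜 := ℂ) (a • u + b • v) g
  rw [h1, inner_self_eq_norm_sq_to_K] at h5
  have h6 : ‖a • u + b • v‖ ^ 2 ≤ ‖a • u + b • v‖ * ‖g‖ := by simpa using h5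
  rw [← h2]
  nlinarith [sq_nonneg (‖a • u + b • v‖ - ‖g‖)]

theorem apply_eq_zero_of_inner_eq_zero {T : H →L[ℂ] H} (hT : 0 ≤ T) {x : H}
    (hx : inner ℂ x (T x) = 0) : T x = 0 := by
  have hs : IsSelfAdjoint (CFC.sqrt T) := IsSelfAdjoint.of_nonneg (CFC.sqrt_nonneg T)
  have h1 : CFC.sqrt T x = 0 := by
    rw [← inner_self_eq_zero (𝕜 := ℂ), inner_apply_left, hs.star_eq, ← mul_apply_eq_comp,
      CFC.sqrt_mul_sqrt_self T hT, hx]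
  rw [← CFC.sqrt_mul_sqrt_self T hT, mul_apply_eq_comp, h1, map_zero]

theorem inner_rankOne_self (u g : H) :
    inner ℂ g (rankOne ℂ u u g) = ((‖inner ℂ u g‖ ^ 2 : ℝ) : ℂ) := by
  rw [rankOne_apply, inner_smul_right, ← inner_conj_symm g u, RCLike.mul_conj]
  simp

/-- Weak associativity rewrites `A² ∘ P_z` as `A ∘ |u⟩⟨u|`, and `g` evaluates the outer product at
`y`. -/
theorem IsSequentialProduct.inner_op_sq {op : Effect H → Effect H → Effect H}
    (h : IsSequentialProduct op) (A : Effect H) {z y : H} (hz : ‖z‖ = 1) {u g : H}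
    (hu : (op A (pureEffect z hz)).1 = rankOne ℂ u u)
    (hg : ∀ B : Effect H, inner ℂ y ((op A B).1 y) = inner ℂ g (B.1 g)) :
    inner ℂ y ((op A.sq (pureEffect z hz)).1 y) = ((‖inner ℂ u g‖ ^ 2 : ℝ) : ℂ) := by
  rw [h.weak_assoc, hg, hu, inner_rankOne_self]

/-! ### The orthogonality argument and the formula for `A² ∘ B` -/

/-- If the transition probability between `z` and `w` under `A²` vanishes, then `A w` is orthogonal
to `z`. -/
theorem IsSequentialProduct.inner_apply_eq_zero {op : Effect H → Effect H → Effect H}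
    (h : IsSequentialProduct op) (A : Effect H) {z w : H} (hz : ‖z‖ = 1) (hw : ‖w‖ = 1)
    (h0 : inner ℂ z ((op A.sq (pureEffect w hw)).1 z) = 0) : inner ℂ z (A.1 w) = 0 := by
  obtain ⟨u, hu⟩ := h.exists_op_pureEffect A hz
  obtain ⟨v, hv⟩ := h.exists_op_pureEffect A hw
  have hvu : inner ℂ v u = 0 := by
    have h1 := h.inner_op_sq A hw hv (h.inner_op hz hu)
    rw [h0] at h1
    have h2 : ‖inner ℂ v u‖ ^ 2 = 0 := by exact_mod_cast h1.symm
    simpa using h2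
  have huv : inner ℂ u v = 0 := inner_eq_zero_symm.1 hvu
  have hzz := h.inner_op_sq A hz hu (h.inner_op hz hu)
  have hww := h.inner_op_sq A hw hv (h.inner_op hw hv)
  -- The condition `⟨u, v⟩ = 0` is symmetric in `z` and `w`. A positive operator with vanishing
  -- quadratic form at a vector kills it, so the cross terms at `y` disappear below.
  have hwz : (op A.sq (pureEffect z hz)).1 w = 0 := by
    refine apply_eq_zero_of_inner_eq_zero (op A.sq (pureEffect z hz)).2.1 ?_
    rw [h.inner_op_sq A hz hu (h.inner_op hw hv), huv]; simp
  have hzw : (op A.sq (pureEffect w hw)).1 z = 0 :=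
    apply_eq_zero_of_inner_eq_zero (op A.sq (pureEffect w hw)).2.1 h0
  have hself : ∀ (E : Effect H) (x y : H), inner ℂ (E.1 x) y = inner ℂ x (E.1 y) :=
    fun E x y => by rw [inner_apply_left, E.isSelfAdjoint.star_eq]
  have hsq : ∀ x : H, (inner ℂ x x : ℂ) = ((‖x‖ ^ 2 : ℝ) : ℂ) := fun x => by
    rw [inner_self_eq_norm_sq_to_K]; simp
  -- This coefficient makes `s ⟨z, A w⟩ = -|s|²`, so the cross terms of `⟨y, A y⟩` contribute
  -- `-2|s|²`.
  set s : ℂ := -(starRingEnd ℂ) (inner ℂ z (A.1 w)) with hs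
  set y : H := z + s • w with hy
  obtain ⟨g, hg⟩ := h.exists_inner_op A y
  have hgu : ‖inner ℂ u g‖ = ‖u‖ ^ 2 := by
    have h1 := h.inner_op_sq A hz hu hg
    have h2 : inner ℂ y ((op A.sq (pureEffect z hz)).1 y) =
        inner ℂ z ((op A.sq (pureEffect z hz)).1 z) := by
      rw [hy, map_add, map_smul, hwz, smul_zero, add_zero, inner_add_left, inner_smul_left,
        ← hself _ w z, hwz, inner_zero_left, mul_zero, add_zero]
    rw [h2, hzz] at h1
    have h3 : ‖inner ℂ u g‖ ^ 2 = ‖inner ℂ u u‖ ^ 2 := by exact_mod_cast h1.symm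
    rw [(sq_eq_sq₀ (norm_nonneg _) (norm_nonneg _)).1 h3, hsq, Complex.norm_real, norm_pow,
      norm_norm]
  have hgv : ‖inner ℂ v g‖ = ‖s‖ * ‖v‖ ^ 2 := by
    have h1 := h.inner_op_sq A hw hv hg
    have h2 : inner ℂ y ((op A.sq (pureEffect w hw)).1 y) =
        ((‖s‖ ^ 2 : ℝ) : ℂ) * inner ℂ w ((op A.sq (pureEffect w hw)).1 w) := by
      rw [hy, map_add, map_smul, hzw, zero_add, inner_add_left, inner_smul_right,
        inner_smul_right, inner_smul_left, ← hself _ z w, hzw, inner_zero_left, mul_zero, zero_add,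
        ← mul_assoc, Complex.mul_conj, Complex.normSq_eq_norm_sq]
    rw [h2, hww, ← Complex.ofReal_mul] at h1
    have h3 : ‖inner ℂ v g‖ ^ 2 = (‖s‖ * ‖inner ℂ v v‖) ^ 2 := by
      rw [mul_pow]; exact_mod_cast h1.symm
    rw [(sq_eq_sq₀ (norm_nonneg _) (by positivity)).1 h3, hsq, Complex.norm_real, norm_pow,
      norm_norm]
  have hb := norm_sq_add_le_of_inner_eq huv hgu hgv
  have hnorm : ∀ {x k : H}, (∀ B : Effect H, inner ℂ x ((op A B).1 x) = inner ℂ k (B.1 k)) →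
      inner ℂ x (A.1 x) = ((‖k‖ ^ 2 : ℝ) : ℂ) := by
    intro x k hk
    have h1 := hk Effect.id
    rw [(h.unit A).1] at h1
    rw [h1, ← hsq]; rfl
  have hq : inner ℂ y (A.1 y) = inner ℂ z (A.1 z) + ((‖s‖ ^ 2 : ℝ) : ℂ) * inner ℂ w (A.1 w)
      - 2 * ((‖s‖ ^ 2 : ℝ) : ℂ) := by
    have hzw' : inner ℂ z (A.1 w) = -(starRingEnd ℂ) s := by simp [hs]
    have hwz' : inner ℂ w (A.1 z) = -s := by
      rw [← hself, ← inner_conj_symm, hzw']; simp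
    have hss : s * (starRingEnd ℂ) s = ((‖s‖ ^ 2 : ℝ) : ℂ) := by
      rw [Complex.mul_conj, Complex.normSq_eq_norm_sq]
    rw [hy, map_add, map_smul, inner_add_left, inner_add_right, inner_add_right, inner_smul_left,
      inner_smul_left, inner_smul_right, inner_smul_right, hzw', hwz', ← hss]
    ring
  rw [hnorm hg, hnorm (h.inner_op hz hu), hnorm (h.inner_op hw hv)] at hq
  have hq' : ‖g‖ ^ 2 = ‖u‖ ^ 2 + ‖s‖ ^ 2 * ‖v‖ ^ 2 - 2 * ‖s‖ ^ 2 := by exact_mod_cast hq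
  -- Bessel bounds `‖g‖²` below by `‖u‖² + |s|²‖v‖²`, which exceeds its actual value by `2|s|²`.
  have hs0 : ‖s‖ = 0 := by nlinarith [sq_nonneg ‖s‖]
  have : (starRingEnd ℂ) (inner ℂ z (A.1 w)) = 0 := by
    rw [← neg_eq_zero, ← hs]; exact norm_eq_zero.1 hs0
  exact (map_eq_zero _).1 this

theorem IsSequentialProduct.op_sq {op : Effect H → Effect H → Effect H}
    (h : IsSequentialProduct op) (A B : Effect H) : (op A.sq B).1 = A.1 * B.1 * A.1 := by
  have key : ∀ w : H, ‖w‖ = 1 → inner ℂ w ((op A.sq B).1 w) = inner ℂ (A.1 w) (B.1 (A.1 w)) := by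
    intro w hw
    obtain ⟨s, hs⟩ := h.exists_op_pureEffect A.sq hw
    -- The line spanned by `s` is its own double orthogonal complement, so it suffices to test
    -- against unit vectors orthogonal to `s`. For these the transition probability vanishes.
    have hmem : A.1 w ∈ (ℂ ∙ s) := by
      rw [← Submodule.orthogonal_orthogonal (ℂ ∙ s), Submodule.mem_orthogonal]
      intro z hz
      have hsz : inner ℂ s z = 0 := Submodule.mem_orthogonal_singleton_iff_inner_right.1 hz
      by_cases hz0 : z = 0
      · simp [hz0]
      obtain ⟨r, e, hr, he, rfl⟩ := exists_unit_smul hz0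
      have hse : inner ℂ s e = 0 := by
        rw [inner_smul_right] at hsz
        exact (mul_eq_zero.1 hsz).resolve_left (Complex.ofReal_ne_zero.2 hr)
      rw [inner_smul_left, h.inner_apply_eq_zero A he hw (by
        rw [hs, inner_rankOne_self, hse]; simp), mul_zero]
    obtain ⟨c, hc⟩ := Submodule.mem_span_singleton.1 hmem
    have hns : inner ℂ s s = inner ℂ (A.1 w) (A.1 w) := by
      have h1 := h.inner_op hw hs Effect.id
      rw [(h.unit _).1] at h1
      have h2 : inner ℂ w (A.sq.1 w) = inner ℂ s s := h1
      rw [← h2, inner_apply_left, A.isSelfAdjoint.star_eq]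
      change inner ℂ w ((A.1 ^ 2) w) = _
      rw [pow_two, mul_apply_eq_comp]
    rw [h.inner_op hw hs B]
    by_cases hs0 : s = 0
    · rw [← hc, hs0]; simp
    rw [← hc, inner_smul_left, inner_smul_right] at hns
    have hss : (inner ℂ s s : ℂ) ≠ 0 := inner_self_ne_zero.2 hs0
    -- Equal norms make `c` a phase, which cancels in the quadratic form of `B`.
    have hcc : (starRingEnd ℂ) c * c = 1 := by
      refine mul_right_cancel₀ hss ?_
      rw [one_mul, mul_assoc]; exact hns.symm
    rw [← hc, map_smul, inner_smul_left, inner_smul_right, ← mul_assoc, hcc, one_mul]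
  have key' : ∀ x : H, inner ℂ ((op A.sq B).1 x) x = inner ℂ ((A.1 * B.1 * A.1) x) x := by
    intro x
    by_cases hx0 : x = 0
    · simp [hx0]
    obtain ⟨r, e, -, he, rfl⟩ := exists_unit_smul hx0
    have h1 : inner ℂ ((op A.sq B).1 e) e = inner ℂ ((A.1 * B.1 * A.1) e) e := by
      rw [← inner_conj_symm, key e he, inner_conj_symm, inner_apply_right,
        A.isSelfAdjoint.star_eq]
      rfl
    simp only [map_smul, inner_smul_left, inner_smul_right, h1]
  have h2 := (ext_inner_map (op A.sq B).1.toLinearMap (A.1 * B.1 * A.1).toLinearMap).1 key'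
  exact ContinuousLinearMap.coe_injective h2

/-- The square root of an effect. -/
noncomputable def Effect.sqrt (A : Effect H) : Effect H :=
  ⟨CFC.sqrt A.1, CFC.sqrt_nonneg A.1,
    (CStarAlgebra.norm_le_one_iff_of_nonneg _ (CFC.sqrt_nonneg A.1)).1 A.norm_sqrt_le_one⟩

theorem Effect.sq_sqrt (A : Effect H) : A.sqrt.sq = A :=
  Subtype.ext (CFC.sq_sqrt A.1 A.2.1)

theorem IsSequentialProduct.eq_standardProduct {op : Effect H → Effect H → Effect H}
    (h : IsSequentialProduct op) (A B : Effect H) : op A B = A.standardProduct B := by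
  refine Subtype.ext ?_
  conv_lhs => rw [← A.sq_sqrt]
  exact h.op_sq A.sqrt B

end QuantumEffects

theorem mainTheorem1 {H : Type*} [NormedAddCommGroup H] [InnerProductSpace ℂ H] [CompleteSpace H]
    (op : QuantumEffects.Effect H → QuantumEffects.Effect H → QuantumEffects.Effect H) :
    QuantumEffects.IsSequentialProduct op ↔
      ∀ A B : QuantumEffects.Effect H, op A B = QuantumEffects.Effect.standardProduct A B := by
  refine ⟨fun h => h.eq_standardProduct, fun h => ?_⟩
  rw [show op = QuantumEffects.Effect.standardProduct from funext fun A => funext (h A)]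
  exact QuantumEffects.isSequentialProduct_standardProduct
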